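/- Let $k$ be a field and let $d\le n$ be non-negative integers. Let $Q_d=\operatorname{Spec} k[q_0,\dots,q_{d-1}]$ be the affine space of monic polynomials $q=t^d+q_{d-1}t^{d-1}+\cdots+q_0$ of degree $d$. Let $\mathcal L_n\mathbb A^1=\operatorname{Spec} k[x_0,\dots,x_n]$ and $\mathcal L_n\mathbb G_m=\operatorname{Spec} k[x_0,\dots,x_n][x_0^{-1}]$ be the spaces of $n$-jets on $\mathbb A^1$ and $\mathbb G_m$, that is, the $k$-schemes representing the functors $R\mapsto R[t]/(t^{n+1})$ and $R\mapsto (R[t]/(t^{n+1}))^\times$ on $k$-algebras, where a point with coordinates $(x_i)$ corresponds to the class of $\sum_{i=0}^n x_it^i$. Let $\mathcal L_n^{\le d}\mathbb A^1\subset\mathcal L_n\mathbb A^1$ be the open subscheme which is the preimage of the complement of the origin under the truncation morphism $\mathcal L_n\mathbb A^1\to\mathcal L_d\mathbb A^1$, $(x_0,\dots,x_n)\mapsto(x_0,\dots,x_d)$. Then $Q_d\times_k\mathcal L_n\mathbb G_m$ and $\mathcal L_n^{\le d}\mathbb A^1$ are $k$-schemes of finite type, and the morphism of $k$-schemes $$\beta_{d,n}\colon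 Q_d\times_k\mathcal L_n\mathbb G_m\to\mathcal L_n^{\le d}\mathbb A^1,\qquad (q,u)\mapsto qu \bmod t^{n+1},$$ is smooth. -/

import Mathlib

open AlgebraicGeometry CategoryTheory CategoryTheory.Limits TensorProduct

universe u

namespace WeierstrassJet

noncomputable section

/-- The coordinate ring `k[x₀, …, xₙ]` of the space of `n`-jets on the affine line. -/
abbrev LineJetRing (k : Type u) [CommRing k] (n : ℕ) : Type u :=
  MvPolynomial (Fin (n + 1)) k

/-- The coordinate ring `k[x₀, …, xₙ][x₀⁻¹]` of the space of `n`-jets on `𝔾ₘ`. -/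
abbrev UnitJetRing (k : Type u) [CommRing k] (n : ℕ) : Type u :=
  Localization.Away (MvPolynomial.X 0 : LineJetRing k n)

/-- The coordinate ring `k[q₀, …, q_{d-1}]` of the space of monic polynomials of degree `d`. -/
abbrev MonicRing (k : Type u) [CommRing k] (d : ℕ) : Type u :=
  MvPolynomial (Fin d) k

/-- The polynomial `x₀ + x₁ t + ⋯ + xₙ tⁿ`, whose class modulo `tⁿ⁺¹` is the universal `n`-jet
on the affine line. -/
def genericJet (k : Type u) [CommRing k] (n : ℕ) : Polynomial (LineJetRing k n) :=
  ∑ i : Fin (n + 1), Polynomial.monomial (i : ℕ) (MvPolynomial.X i)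

/-- The universal `n`-jet on `𝔾ₘ`. -/
def genericUnitJet (k : Type u) [CommRing k] (n : ℕ) : Polynomial (UnitJetRing k n) :=
  (genericJet k n).map (algebraMap (LineJetRing k n) (UnitJetRing k n))

/-- The universal monic polynomial `t^d + q_{d-1} t^{d-1} + ⋯ + q₀`. -/
def genericMonic (k : Type u) [CommRing k] (d : ℕ) : Polynomial (MonicRing k d) :=
  Polynomial.X ^ d + ∑ i : Fin d, Polynomial.monomial (i : ℕ) (MvPolynomial.X i)

/-- The product `q u` of the universal monic polynomial and the universal `n`-jet on `𝔾ₘ`, as a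
polynomial in `t` over the coordinate ring of the product of the two spaces. -/
def genericProduct (k : Type u) [CommRing k] (d n : ℕ) :
    Polynomial (MonicRing k d ⊗[k] UnitJetRing k n) :=
  (genericMonic k d).map
      (Algebra.TensorProduct.includeLeft :
        MonicRing k d →ₐ[k] MonicRing k d ⊗[k] UnitJetRing k n).toRingHom *
    (genericUnitJet k n).map
      (Algebra.TensorProduct.includeRight :
        UnitJetRing k n →ₐ[k] MonicRing k d ⊗[k] UnitJetRing k n).toRingHom

/-- The map on coordinate rings given by `(q, u) ↦ q u mod tⁿ⁺¹`: the coordinate `xᵢ` goes to the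
coefficient of `tⁱ` in `q u`. -/
def betaRing (k : Type u) [CommRing k] (d n : ℕ) :
    LineJetRing k n →ₐ[k] MonicRing k d ⊗[k] UnitJetRing k n :=
  MvPolynomial.aeval fun i => (genericProduct k d n).coeff i

/-- The affine scheme over `k` of a `k`-algebra: its structure morphism. -/
abbrev specStr (k A : Type u) [CommRing k] [CommRing A] [Algebra k A] :
    Spec (.of A) ⟶ Spec (.of k) :=
  Spec.map (CommRingCat.ofHom (algebraMap k A))

/-- The space `𝓛ₙ𝔸¹` of `n`-jets on the affine line. -/
abbrev LineJet (k : Type u) [CommRing k] (n : ℕ) : Scheme.{u} :=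
  Spec (.of (LineJetRing k n))

/-- The space `𝓛ₙ𝔾ₘ` of `n`-jets on `𝔾ₘ`. -/
abbrev UnitJet (k : Type u) [CommRing k] (n : ℕ) : Scheme.{u} :=
  Spec (.of (UnitJetRing k n))

/-- The space `Q_d` of monic polynomials of degree `d`. -/
abbrev MonicSpace (k : Type u) [CommRing k] (d : ℕ) : Scheme.{u} :=
  Spec (.of (MonicRing k d))

/-- The fibre product `Q_d × 𝓛ₙ𝔾ₘ` over `k`. -/
abbrev Source (k : Type u) [CommRing k] (d n : ℕ) : Scheme.{u} :=
  pullback (specStr k (MonicRing k d)) (specStr k (UnitJetRing k n))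

/-- The structure morphism of `Q_d × 𝓛ₙ𝔾ₘ`. -/
abbrev sourceStr (k : Type u) [CommRing k] (d n : ℕ) : Source k d n ⟶ Spec (.of k) :=
  pullback.fst (specStr k (MonicRing k d)) (specStr k (UnitJetRing k n)) ≫
    specStr k (MonicRing k d)

/-- The truncation map `x₀, …, x_d ↦ x₀, …, x_d` on coordinate rings. -/
def truncRing (k : Type u) [CommRing k] {d n : ℕ} (h : d ≤ n) :
    LineJetRing k d →ₐ[k] LineJetRing k n :=
  MvPolynomial.rename (Fin.castLE (Nat.succ_le_succ h))

/-- The truncation morphism `𝓛ₙ𝔸¹ ⟶ 𝓛_d𝔸¹` for `d ≤ n`. -/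
def trunc (k : Type u) [CommRing k] {d n : ℕ} (h : d ≤ n) : LineJet k n ⟶ LineJet k d :=
  Spec.map (CommRingCat.ofHom (truncRing k h).toRingHom)

/-- The complement of the origin `x₀ = ⋯ = x_d = 0` in `𝓛_d𝔸¹`. -/
def punctured (k : Type u) [CommRing k] (d : ℕ) : (LineJet k d).Opens :=
  ⟨(PrimeSpectrum.zeroLocus (Set.range (MvPolynomial.X : Fin (d + 1) → LineJetRing k d)))ᶜ,
    (PrimeSpectrum.isClosed_zeroLocus _).isOpen_compl⟩

/-- The open subscheme `𝓛ₙ^{≤ d}𝔸¹` of `𝓛ₙ𝔸¹`: the preimage under truncation of the complement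
of the origin of `𝓛_d𝔸¹`. -/
def boundedJet (k : Type u) [CommRing k] {d n : ℕ} (h : d ≤ n) : (LineJet k n).Opens :=
  trunc k h ⁻¹ᵁ punctured k d

/-- The structure morphism of `𝓛ₙ^{≤ d}𝔸¹`. -/
abbrev boundedJetStr (k : Type u) [CommRing k] {d n : ℕ} (h : d ≤ n) :
    (boundedJet k h : Scheme.{u}) ⟶ Spec (.of k) :=
  (boundedJet k h).ι ≫ specStr k (LineJetRing k n)

/-- The morphism `(q, u) ↦ q u` with values in `𝓛ₙ𝔸¹`. -/
def betaAmbient (k : Type u) [CommRing k] (d n : ℕ) : Source k d n ⟶ LineJet k n :=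
  (pullbackSpecIso k (MonicRing k d) (UnitJetRing k n)).hom ≫
    Spec.map (CommRingCat.ofHom (betaRing k d n).toRingHom)

theorem genericJet_coeff (k : Type u) [CommRing k] (n : ℕ) (i : Fin (n + 1)) :
    (genericJet k n).coeff i = MvPolynomial.X i := by
  simp [genericJet, Polynomial.coeff_monomial, Fin.val_inj]

theorem genericMonic_coeff_top (k : Type u) [CommRing k] (d : ℕ) :
    (genericMonic k d).coeff d = 1 := by
  have : ∀ i : Fin d, (i : ℕ) ≠ d := fun i => i.2.ne
  simp [genericMonic, Polynomial.coeff_monomial, this]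

theorem genericMonic_coeff (k : Type u) [CommRing k] (d : ℕ) (i : Fin d) :
    (genericMonic k d).coeff i = MvPolynomial.X i := by
  simp [genericMonic, Polynomial.coeff_monomial, Fin.val_inj, Polynomial.coeff_X_pow, i.2.ne]

theorem coeff_mem_of_mul {B : Type*} [CommRing B] (P : Ideal B) (q v : Polynomial B)
    (hv : IsUnit (v.coeff 0)) (d : ℕ) (h : ∀ i, i ≤ d → (q * v).coeff i ∈ P) :
    q.coeff d ∈ P := by
  let φ := Ideal.Quotient.mk P
  have h1 : (PowerSeries.X : PowerSeries (B ⧸ P)) ^ (d + 1) ∣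
      ((q.map φ : Polynomial (B ⧸ P)) : PowerSeries (B ⧸ P)) *
        ((v.map φ : Polynomial (B ⧸ P)) : PowerSeries (B ⧸ P)) := by
    rw [← Polynomial.coe_mul, ← Polynomial.map_mul, PowerSeries.X_pow_dvd_iff]
    intro i hi
    rw [Polynomial.coeff_coe, Polynomial.coeff_map]
    exact Ideal.Quotient.eq_zero_iff_mem.2 (h i (by omega))
  have h2 : IsUnit ((v.map φ : Polynomial (B ⧸ P)) : PowerSeries (B ⧸ P)) := by
    rw [PowerSeries.isUnit_iff_constantCoeff, ← PowerSeries.coeff_zero_eq_constantCoeff_apply,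
      Polynomial.coeff_coe, Polynomial.coeff_map]
    exact hv.map φ
  have h3 := (h2.dvd_mul_right).1 h1
  rw [PowerSeries.X_pow_dvd_iff] at h3
  have h4 := h3 d (by omega)
  rw [Polynomial.coeff_coe, Polynomial.coeff_map] at h4
  exact Ideal.Quotient.eq_zero_iff_mem.1 h4

/-- The product `q u` has a nonzero coefficient among those of `1, t, …, t^d` at every point. -/
theorem range_betaAmbient (k : Type u) [CommRing k] {d n : ℕ} (h : d ≤ n) :
    Set.range (betaAmbient k d n) ⊆ Set.range (boundedJet k h).ι := by
  rw [Scheme.Opens.range_ι]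
  rintro _ ⟨z, rfl⟩
  rw [betaAmbient, Scheme.Hom.comp_apply]
  generalize (pullbackSpecIso k (MonicRing k d) (UnitJetRing k n)).hom z = p
  change PrimeSpectrum (MonicRing k d ⊗[k] UnitJetRing k n) at p
  intro hp
  have hmem : ∀ i, i ≤ d → (genericProduct k d n).coeff i ∈ p.asIdeal := by
    intro i hi
    have h1 : betaRing k d n (truncRing k h (MvPolynomial.X ⟨i, Nat.lt_succ_of_le hi⟩)) ∈
        p.asIdeal := hp ⟨⟨i, Nat.lt_succ_of_le hi⟩, rfl⟩
    simpa [truncRing, betaRing] using h1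
  have h0 : IsUnit ((genericUnitJet k n).coeff 0) := by
    have := genericJet_coeff k n 0
    rw [Fin.val_zero] at this
    rw [genericUnitJet, Polynomial.coeff_map, this]
    exact IsLocalization.Away.algebraMap_isUnit _
  have h2 := coeff_mem_of_mul p.asIdeal _ _
    (by rw [Polynomial.coeff_map]; exact h0.map _) d hmem
  rw [Polynomial.coeff_map, genericMonic_coeff_top, map_one] at h2
  exact p.isPrime.ne_top ((Ideal.eq_top_iff_one _).2 h2)

/-- The finite-level Weierstrass morphism
`β_{d,n} : Q_d × 𝓛ₙ𝔾ₘ ⟶ 𝓛ₙ^{≤ d}𝔸¹`, `(q, u) ↦ q u`, for `d ≤ n`. -/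
def beta (k : Type u) [CommRing k] {d n : ℕ} (h : d ≤ n) :
    Source k d n ⟶ (boundedJet k h : Scheme.{u}) :=
  IsOpenImmersion.lift (boundedJet k h).ι (betaAmbient k d n) (range_betaAmbient k h)

/-! The functors of points of the spaces above. -/

/-- The ring `R[t]/(tⁿ⁺¹)`. -/
abbrev Trunc (R : Type*) [CommRing R] (n : ℕ) :=
  Polynomial R ⧸ Ideal.span {(Polynomial.X : Polynomial R) ^ (n + 1)}

/-- The element of `𝔸¹(R[t]/(tⁿ⁺¹))` given by an `R`-point of `𝓛ₙ𝔸¹`. -/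
def linePoint {k : Type u} [CommRing k] {n : ℕ} {R : Type*} [CommRing R] [Algebra k R]
    (φ : LineJetRing k n →ₐ[k] R) : Trunc R n :=
  Ideal.Quotient.mk _ ((genericJet k n).map φ.toRingHom)

/-- The element of `R[t]/(tⁿ⁺¹)` given by an `R`-point of `𝓛ₙ𝔾ₘ`. -/
def unitPoint {k : Type u} [CommRing k] {n : ℕ} {R : Type*} [CommRing R] [Algebra k R]
    (φ : UnitJetRing k n →ₐ[k] R) : Trunc R n :=
  Ideal.Quotient.mk _ ((genericUnitJet k n).map φ.toRingHom)

/-- The polynomial over `R` given by an `R`-point of `Q_d`. -/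
def monicPoint {k : Type u} [CommRing k] {d : ℕ} {R : Type*} [CommRing R] [Algebra k R]
    (φ : MonicRing k d →ₐ[k] R) : Polynomial R :=
  (genericMonic k d).map φ.toRingHom

theorem trunc_mk_eq_iff {R : Type*} [CommRing R] {n : ℕ} (f g : Polynomial R) :
    (Ideal.Quotient.mk _ f : Trunc R n) = Ideal.Quotient.mk _ g ↔
      ∀ i, i < n + 1 → f.coeff i = g.coeff i := by
  rw [Ideal.Quotient.eq, Ideal.mem_span_singleton, Polynomial.X_pow_dvd_iff]
  simp [sub_eq_zero]

/-- `𝓛ₙ𝔸¹` represents `R ↦ 𝔸¹(R[t]/(tⁿ⁺¹))`. -/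
theorem linePoint_bijective (k : Type u) [CommRing k] (n : ℕ) (R : Type*) [CommRing R]
    [Algebra k R] :
    Function.Bijective (linePoint : (LineJetRing k n →ₐ[k] R) → Trunc R n) := by
  constructor
  · intro φ ψ hφ
    rw [linePoint, linePoint, trunc_mk_eq_iff] at hφ
    refine MvPolynomial.algHom_ext fun i => ?_
    simpa [genericJet_coeff] using hφ i i.2
  · intro y
    obtain ⟨f, rfl⟩ := Ideal.Quotient.mk_surjective y
    refine ⟨MvPolynomial.aeval fun i => f.coeff i, ?_⟩
    rw [linePoint, trunc_mk_eq_iff]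
    intro i hi
    simpa using congrArg (MvPolynomial.aeval fun i : Fin (n + 1) => f.coeff i)
      (genericJet_coeff k n ⟨i, hi⟩)

theorem trunc_isUnit_iff {R : Type*} [CommRing R] {n : ℕ} (f : Polynomial R) :
    IsUnit (Ideal.Quotient.mk _ f : Trunc R n) ↔ IsUnit (f.coeff 0) := by
  constructor
  · intro h
    obtain ⟨y, hy⟩ := h.exists_right_inv
    obtain ⟨g, rfl⟩ := Ideal.Quotient.mk_surjective y
    rw [← map_mul, ← map_one (Ideal.Quotient.mk _), trunc_mk_eq_iff] at hy
    have := hy 0 (by omega)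
    rw [Polynomial.mul_coeff_zero, Polynomial.coeff_one_zero] at this
    exact IsUnit.of_mul_eq_one _ this
  · intro h
    have hn : IsNilpotent (Ideal.Quotient.mk _ (Polynomial.X * f.divX) : Trunc R n) := by
      refine ⟨n + 1, ?_⟩
      rw [← map_pow, Ideal.Quotient.eq_zero_iff_mem, Ideal.mem_span_singleton, mul_pow]
      exact dvd_mul_right _ _
    have hu : IsUnit (Ideal.Quotient.mk _ (Polynomial.C (f.coeff 0)) : Trunc R n) :=
      (h.map Polynomial.C).map _
    have := hn.isUnit_add_left_of_commute hu (Commute.all _ _)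
    rwa [← map_add, add_comm (Polynomial.C _), Polynomial.X_mul_divX_add] at this

/-- `𝓛ₙ𝔾ₘ` represents `R ↦ 𝔾ₘ(R[t]/(tⁿ⁺¹))`: points are determined by their jets. -/
theorem unitPoint_injective (k : Type u) [CommRing k] (n : ℕ) (R : Type*) [CommRing R]
    [Algebra k R] :
    Function.Injective (unitPoint : (UnitJetRing k n →ₐ[k] R) → Trunc R n) := by
  intro φ ψ h
  have hc : φ.comp (IsScalarTower.toAlgHom k (LineJetRing k n) (UnitJetRing k n)) =
      ψ.comp (IsScalarTower.toAlgHom k (LineJetRing k n) (UnitJetRing k n)) := by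
    apply (linePoint_bijective k n R).1
    rw [unitPoint, unitPoint, genericUnitJet, Polynomial.map_map, Polynomial.map_map] at h
    exact h
  refine AlgHom.coe_ringHom_injective (IsLocalization.ringHom_ext
    (Submonoid.powers (MvPolynomial.X 0 : LineJetRing k n)) ?_)
  exact congrArg AlgHom.toRingHom hc

/-- `𝓛ₙ𝔾ₘ` represents `R ↦ 𝔾ₘ(R[t]/(tⁿ⁺¹))`: the jets are the units of `R[t]/(tⁿ⁺¹)`. -/
theorem range_unitPoint (k : Type u) [CommRing k] (n : ℕ) (R : Type*) [CommRing R]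
    [Algebra k R] :
    Set.range (unitPoint : (UnitJetRing k n →ₐ[k] R) → Trunc R n) = {y | IsUnit y} := by
  have hz : (genericJet k n).coeff 0 = MvPolynomial.X 0 := genericJet_coeff k n 0
  ext y
  constructor
  · rintro ⟨φ, rfl⟩
    rw [Set.mem_ofPred_eq, unitPoint, trunc_isUnit_iff, Polynomial.coeff_map, genericUnitJet,
      Polynomial.coeff_map, hz]
    exact (IsLocalization.Away.algebraMap_isUnit (MvPolynomial.X 0 : LineJetRing k n)).map _
  · intro hy
    obtain ⟨φ, rfl⟩ := (linePoint_bijective k n R).2 y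
    rw [Set.mem_ofPred_eq, linePoint, trunc_isUnit_iff, Polynomial.coeff_map, hz] at hy
    have hy' : IsUnit (φ (MvPolynomial.X 0)) := hy
    refine ⟨IsLocalization.liftAlgHom
      (M := Submonoid.powers (MvPolynomial.X 0 : LineJetRing k n)) (f := φ) ?_, ?_⟩
    · rintro ⟨_, m, rfl⟩
      simpa using hy'.pow m
    · rw [unitPoint, linePoint, genericUnitJet, Polynomial.map_map]
      congr 2
      ext x <;> simp

/-- `Q_d` represents `R ↦ {monic polynomials of degree d over R}`: points are determined by their
polynomials. -/
theorem monicPoint_injective (k : Type u) [CommRing k] (d : ℕ) (R : Type*) [CommRing R]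
    [Algebra k R] :
    Function.Injective (monicPoint : (MonicRing k d →ₐ[k] R) → Polynomial R) := by
  intro φ ψ h
  refine MvPolynomial.algHom_ext fun i => ?_
  have hi := congrArg (fun q => Polynomial.coeff q (i : ℕ)) h
  simpa [monicPoint, genericMonic_coeff, i.2.ne] using hi

/-- `Q_d` represents `R ↦ {monic polynomials of degree d over R}`: the polynomials are those of the
form `t^d + a` with `deg a < d`. -/
theorem range_monicPoint (k : Type u) [CommRing k] (d : ℕ) (R : Type*) [CommRing R]
    [Algebra k R] :
    Set.range (monicPoint : (MonicRing k d →ₐ[k] R) → Polynomial R) =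
      {q | ∃ a : Polynomial R, a.degree < d ∧ q = Polynomial.X ^ d + a} := by
  ext q
  constructor
  · rintro ⟨φ, rfl⟩
    refine ⟨∑ i : Fin d, Polynomial.monomial (i : ℕ) (φ (MvPolynomial.X i)), ?_, ?_⟩
    · exact (Polynomial.degree_sum_le _ _).trans_lt ((Finset.sup_lt_iff (WithBot.bot_lt_coe d)).2
        fun i _ => (Polynomial.degree_monomial_le _ _).trans_lt (Nat.cast_lt.2 i.2))
    · simp [monicPoint, genericMonic, Polynomial.map_sum]
  · rintro ⟨a, ha, rfl⟩
    refine ⟨MvPolynomial.aeval fun i => a.coeff i, ?_⟩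
    simp only [monicPoint, genericMonic, Polynomial.map_add, Polynomial.map_pow, Polynomial.map_X,
      Polynomial.map_sum, Polynomial.map_monomial]
    congr 1
    ext j
    by_cases hj : j < d
    · obtain ⟨j, rfl⟩ : ∃ j' : Fin d, (j' : ℕ) = j := ⟨⟨j, hj⟩, rfl⟩
      simp [Polynomial.coeff_monomial, Fin.val_inj]
    · have h1 : ∀ i : Fin d, (i : ℕ) ≠ j := fun i hi => hj (hi ▸ i.2)
      rw [Polynomial.coeff_eq_zero_of_degree_lt
        (ha.trans_le (Nat.cast_le.2 (not_lt.1 hj)))]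
      simp [Polynomial.coeff_monomial, h1]

/-- On `R`-points, `β_{d,n}` is `(q, u) ↦ q u`. -/
theorem linePoint_betaRing (k : Type u) [CommRing k] (d n : ℕ) (R : Type*) [CommRing R]
    [Algebra k R] (φ : MonicRing k d →ₐ[k] R) (ψ : UnitJetRing k n →ₐ[k] R) :
    linePoint ((Algebra.TensorProduct.productMap φ ψ).comp (betaRing k d n)) =
      Ideal.Quotient.mk _ (monicPoint φ) * unitPoint ψ := by
  have h : (genericProduct k d n).map (Algebra.TensorProduct.productMap φ ψ).toRingHom =
      monicPoint φ * (genericUnitJet k n).map ψ.toRingHom := by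
    rw [genericProduct, Polynomial.map_mul, Polynomial.map_map, Polynomial.map_map, monicPoint]
    congr 2
    · ext x <;> simp
    · ext x
      simp
  rw [linePoint, unitPoint, ← map_mul, ← h, trunc_mk_eq_iff]
  intro i hi
  have hg : (genericJet k n).coeff i = MvPolynomial.X ⟨i, hi⟩ := genericJet_coeff k n ⟨i, hi⟩
  rw [Polynomial.coeff_map, Polynomial.coeff_map, hg]
  simp [betaRing]

end

end WeierstrassJet

/-! Smoothness is formal smoothness plus finite presentation, and formal smoothness is a linearised
Weierstrass division. Given a jet `F` over `C` and a factorization `(q, u)` of it modulo a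
square-zero ideal, lift to `q`, `v₀` arbitrarily and let `e` be the error `F - q v₀`. A correction
`(q + r)(v₀ + v₀ s)` changes the product by `v₀ (r + q s)`, because `r s = 0`. With `w` inverse to
`v₀` modulo `tⁿ⁺¹`, Euclidean division of `w e` by the monic `q` supplies `r` of degree `< d` and
`s`, and the error disappears. This is `exists_lift_factorization`; the functors of points turn it
into the lifting property in `formallySmooth_betaRing`. Finally `beta` is a base change of
`betaAmbient` along an open immersion. -/

namespace WeierstrassJet

/-! ### Lifting factorizations along square-zero extensions -/

open Polynomial in
/-- A factorization `q u ≡ F` modulo `tⁿ⁺¹` with `q` monic of degree `d` and `u` a unit lifts along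
a square-zero extension. -/
theorem exists_lift_factorization {C D : Type*} [CommRing C] [CommRing D] (π : C →+* D)
    (hπ : Function.Surjective π) (hker : ∀ x y, π x = 0 → π y = 0 → x * y = 0) (d n : ℕ)
    (a u : D[X]) (ha : a.degree < d) (hu : IsUnit (u.coeff 0)) (F : C[X])
    (hF : X ^ (n + 1) ∣ F.map π - (X ^ d + a) * u) :
    ∃ b v : C[X], b.degree < d ∧ IsUnit (v.coeff 0) ∧ b.map π = a ∧ v.map π = u ∧
      X ^ (n + 1) ∣ F - (X ^ d + b) * v := by
  have unit_of_map (c : C) (hc : IsUnit (π c)) : IsUnit c := by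
    obtain ⟨y, hy⟩ := hc.exists_right_inv
    obtain ⟨y, rfl⟩ := hπ y
    have hz : π (1 - c * y) = 0 := by simp [hy]
    -- With `z = 1 - c y` and `z² = 0`, the inverse of `c y = 1 - z` is `1 + z = 2 - c y`.
    exact IsUnit.of_mul_eq_one (y * (2 - c * y)) (by linear_combination -hker _ _ hz hz)
  rcases subsingleton_or_nontrivial C with hC | hC
  · have hD : Subsingleton D := hπ.subsingleton
    exact ⟨0, 0, by simp, isUnit_of_subsingleton _, Subsingleton.elim _ _,
      Subsingleton.elim _ _, by simp [Subsingleton.elim F 0]⟩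
  obtain ⟨b₁, hb₁⟩ := map_surjective π hπ a
  obtain ⟨v₀, hv₀⟩ := map_surjective π hπ u
  obtain ⟨b₀, hb₀d, hb₀⟩ : ∃ b₀ : C[X], b₀.degree < d ∧ b₀.map π = a := by
    -- An arbitrary lift of `a` may have spurious terms of degree `≥ d`; the remainder discards
    -- them.
    refine ⟨b₁ %ₘ X ^ d, (degree_modByMonic_lt _ (monic_X_pow d)).trans_eq (degree_X_pow d), ?_⟩
    rw [map_modByMonic π (monic_X_pow d), hb₁, Polynomial.map_pow, map_X]
    rcases subsingleton_or_nontrivial D with hD | hD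
    · exact Subsingleton.elim _ _
    · exact (modByMonic_eq_self_iff (monic_X_pow d)).2 (by rwa [degree_X_pow])
  have hv₀u : IsUnit (v₀.coeff 0) := unit_of_map _ (by rwa [← coeff_map, hv₀])
  obtain ⟨w, hw⟩ : ∃ w : C[X], X ^ (n + 1) ∣ v₀ * w - 1 := by
    obtain ⟨y, hy⟩ := ((trunc_isUnit_iff (n := n) v₀).2 hv₀u).exists_right_inv
    obtain ⟨w, rfl⟩ := Ideal.Quotient.mk_surjective y
    exact ⟨w, by rwa [← map_mul, ← map_one (Ideal.Quotient.mk _), Ideal.Quotient.eq,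
      Ideal.mem_span_singleton] at hy⟩
  set q : C[X] := X ^ d + b₀ with hq
  have hqm : q.Monic := monic_X_pow_add hb₀d
  have hqd : q.degree = d := by
    rw [hq, degree_add_eq_left_of_degree_lt (by rwa [degree_X_pow]), degree_X_pow]
  -- Only the coefficients of `F - q v₀` up to degree `n` are known to lie in the kernel of `π`;
  -- after truncation all of them do.
  set e : C[X] := (F - q * v₀) %ₘ X ^ (n + 1) with he
  have heπ : e.map π = 0 := by
    rw [he, map_modByMonic π (monic_X_pow _), Polynomial.map_pow, map_X,
      modByMonic_eq_zero_iff_dvd (monic_X_pow _)]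
    simpa [hq, hb₀, hv₀] using hF
  have hed : X ^ (n + 1) ∣ (F - q * v₀) - e := by
    refine ⟨(F - q * v₀) /ₘ X ^ (n + 1), ?_⟩
    linear_combination -modByMonic_add_div (F - q * v₀) (X ^ (n + 1))
  set s := (w * e) /ₘ q with hs
  set r := (w * e) %ₘ q with hr
  have hrs : r + q * s = w * e := modByMonic_add_div _ _
  -- Division by a monic polynomial commutes with `π`, so quotient and remainder of `w e` also
  -- vanish under `π`.
  have hsπ : s.map π = 0 := by rw [hs, map_divByMonic π hqm]; simp [heπ]
  have hrπ : r.map π = 0 := by rw [hr, map_modByMonic π hqm]; simp [heπ]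
  have hrs0 : r * s = 0 := by
    ext i
    rw [coeff_mul, coeff_zero]
    refine Finset.sum_eq_zero fun p _ => hker _ _ ?_ ?_
    · rw [← coeff_map, hrπ, coeff_zero]
    · rw [← coeff_map, hsπ, coeff_zero]
  have hvπ : (v₀ + v₀ * s).map π = u := by simp [hv₀, hsπ]
  refine ⟨b₀ + r, v₀ + v₀ * s, ?_, unit_of_map _ ?_, by simp [hb₀, hrπ], hvπ, ?_⟩
  · exact (degree_add_le _ _).trans_lt
      (max_lt hb₀d ((degree_modByMonic_lt _ hqm).trans_eq hqd))
  · rwa [← coeff_map, hvπ]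
  · have : F - (X ^ d + (b₀ + r)) * (v₀ + v₀ * s) = (F - q * v₀ - e) - (v₀ * w - 1) * e := by
      rw [← add_assoc, ← hq]
      linear_combination -v₀ * hrs - v₀ * hrs0
    rw [this]
    exact dvd_sub hed (hw.mul_right _)

/-! ### Formal smoothness on coordinate rings -/

theorem linePoint_eq_iff {k : Type u} [CommRing k] {n : ℕ} {R : Type*} [CommRing R] [Algebra k R]
    (φ : LineJetRing k n →ₐ[k] R) (f : Polynomial R) :
    linePoint φ = Ideal.Quotient.mk _ f ↔
      Polynomial.X ^ (n + 1) ∣ (genericJet k n).map φ.toRingHom - f := by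
  rw [linePoint, Ideal.Quotient.eq, Ideal.mem_span_singleton]

theorem formallySmooth_betaRing (k : Type u) [CommRing k] (d n : ℕ) :
    (betaRing k d n).toRingHom.FormallySmooth := by
  let := (betaRing k d n).toRingHom.toAlgebra
  change Algebra.FormallySmooth (LineJetRing k n) (MonicRing k d ⊗[k] UnitJetRing k n)
  have : IsScalarTower k (LineJetRing k n) (MonicRing k d ⊗[k] UnitJetRing k n) :=
    IsScalarTower.of_algebraMap_eq' (betaRing k d n).comp_algebraMap.symm
  refine .of_comp_surjective fun C _ _ I hI g => ?_
  let : Algebra k C := ((algebraMap (LineJetRing k n) C).comp (algebraMap k _)).toAlgebra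
  have : IsScalarTower k (LineJetRing k n) C := IsScalarTower.of_algebraMap_eq' rfl
  let π : C →ₐ[k] C ⧸ I := Ideal.Quotient.mkₐ k I
  let ρ : LineJetRing k n →ₐ[k] C := IsScalarTower.toAlgHom k _ C
  let g' : MonicRing k d ⊗[k] UnitJetRing k n →ₐ[k] C ⧸ I := g.restrictScalars k
  let φ := g'.comp Algebra.TensorProduct.includeLeft
  let ψ := g'.comp Algebra.TensorProduct.includeRight
  have hg' : Algebra.TensorProduct.productMap φ ψ = g' := by
    refine Algebra.TensorProduct.ext' fun x y => ?_
    rw [Algebra.TensorProduct.productMap_apply_tmul]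
    simp [φ, ψ, ← map_mul]
  -- The structure map `ρ` is a jet over `C`; linearity of `g` says that its reduction is the
  -- product of the factors `φ` and `ψ`.
  have hgρ : g'.comp (betaRing k d n) = π.comp ρ := AlgHom.ext fun x => g.commutes x
  obtain ⟨a, ha, hφ⟩ : monicPoint φ ∈ {q | ∃ a : Polynomial (C ⧸ I), a.degree < d ∧
      q = Polynomial.X ^ d + a} := range_monicPoint k d (C ⧸ I) ▸ ⟨φ, rfl⟩
  have hψ : IsUnit (unitPoint ψ) := (range_unitPoint k n (C ⧸ I)).subset ⟨ψ, rfl⟩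
  rw [unitPoint, trunc_isUnit_iff] at hψ
  have hfac := linePoint_betaRing k d n (C ⧸ I) φ ψ
  rw [hg', hgρ, unitPoint, ← map_mul, linePoint_eq_iff, hφ] at hfac
  obtain ⟨b, v, hb, hv, hbπ, hvπ, hF⟩ := exists_lift_factorization π.toRingHom
    (Ideal.Quotient.mk_surjective) (fun x y hx hy => by
      have : x * y ∈ I ^ 2 := by
        rw [pow_two]
        exact Ideal.mul_mem_mul (Ideal.Quotient.eq_zero_iff_mem.1 hx)
          (Ideal.Quotient.eq_zero_iff_mem.1 hy)
      rwa [hI] at this) d n a _ ha hψ ((genericJet k n).map ρ.toRingHom)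
    (by rw [Polynomial.map_map]; exact hfac)
  obtain ⟨φ', hφ'⟩ : Polynomial.X ^ d + b ∈
      Set.range (monicPoint : (MonicRing k d →ₐ[k] C) → Polynomial C) :=
    range_monicPoint k d C ▸ ⟨b, hb, rfl⟩
  obtain ⟨ψ', hψ'⟩ : Ideal.Quotient.mk _ v ∈
      Set.range (unitPoint : (UnitJetRing k n →ₐ[k] C) → Trunc C n) :=
    (range_unitPoint k n C).superset ((trunc_isUnit_iff v).2 hv)
  have hρ : (Algebra.TensorProduct.productMap φ' ψ').comp (betaRing k d n) = ρ := by
    apply (linePoint_bijective k n C).1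
    rw [linePoint_betaRing, hφ', hψ', ← map_mul]
    exact ((linePoint_eq_iff _ _).2 hF).symm
  have hφφ' : π.comp φ' = φ := by
    apply monicPoint_injective k d
    have : monicPoint (π.comp φ') = (monicPoint φ').map π.toRingHom := by
      rw [monicPoint, monicPoint, Polynomial.map_map]; rfl
    rw [this, hφ', hφ, ← hbπ]
    simp
  have hψψ' : π.comp ψ' = ψ := by
    apply unitPoint_injective k n
    -- The jet of `ψ'` agrees with `v` only modulo `tⁿ⁺¹`, so the comparison is made on coefficients
    -- up to `n`.
    rw [unitPoint, trunc_mk_eq_iff] at hψ'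
    rw [unitPoint, unitPoint, ← hvπ, trunc_mk_eq_iff]
    intro i hi
    rw [Polynomial.coeff_map π.toRingHom, ← hψ' i hi, Polynomial.coeff_map, Polynomial.coeff_map]
    rfl
  -- `hρ` is exactly the linearity of the lift over `LineJetRing k n`.
  refine ⟨⟨(Algebra.TensorProduct.productMap φ' ψ').toRingHom, fun x => DFunLike.congr_fun hρ x⟩,
    AlgHom.restrictScalars_injective k ?_⟩
  change π.comp (Algebra.TensorProduct.productMap φ' ψ') = g'
  rw [← hg', ← hφφ', ← hψψ']
  ext <;> simp

/-! ### Finite presentation and smoothness of the ring map -/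

instance finitePresentation_unitJetRing (k : Type u) [CommRing k] (n : ℕ) :
    Algebra.FinitePresentation k (UnitJetRing k n) :=
  have : Algebra.FinitePresentation (LineJetRing k n) (UnitJetRing k n) :=
    IsLocalization.Away.finitePresentation (MvPolynomial.X 0)
  .trans k (LineJetRing k n) _

theorem finitePresentation_tensorProduct (k A B : Type*) [CommRing k] [CommRing A] [CommRing B]
    [Algebra k A] [Algebra k B] [Algebra.FinitePresentation k A] [Algebra.FinitePresentation k B] :
    Algebra.FinitePresentation k (A ⊗[k] B) :=
  .trans k A _

theorem smooth_betaRing (k : Type u) [CommRing k] (d n : ℕ) :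
    (betaRing k d n).toRingHom.Smooth := by
  refine RingHom.smooth_def.2 ⟨formallySmooth_betaRing k d n, ?_⟩
  -- Cancellation: the target is finitely presented over `k` and the source is of finite type over
  -- `k`.
  refine RingHom.FinitePresentation.of_comp_finiteType (algebraMap k (LineJetRing k n)) ?_ ?_
  · rw [show (betaRing k d n).toRingHom.comp (algebraMap k (LineJetRing k n)) = algebraMap k _ from
      (betaRing k d n).comp_algebraMap, RingHom.finitePresentation_algebraMap]
    exact finitePresentation_tensorProduct k _ _
  · rw [RingHom.finiteType_algebraMap]
    infer_instance

/-! ### From rings to schemes -/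

theorem smooth_betaAmbient (k : Type u) [CommRing k] (d n : ℕ) : Smooth (betaAmbient k d n) := by
  have : Smooth (Spec.map (CommRingCat.ofHom (betaRing k d n).toRingHom)) :=
    (HasRingHomProperty.Spec_iff (P := @Smooth)).2 (smooth_betaRing k d n)
  rw [betaAmbient]
  infer_instance

theorem beta_ι (k : Type u) [CommRing k] {d n : ℕ} (h : d ≤ n) :
    beta k h ≫ (boundedJet k h).ι = betaAmbient k d n :=
  IsOpenImmersion.lift_fac _ _ _

theorem smooth_beta (k : Type u) [CommRing k] {d n : ℕ} (h : d ≤ n) : Smooth (beta k h) := by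
  have := smooth_betaAmbient k d n
  rw [← beta_ι k h] at this
  -- Since the open immersion `ι` is a monomorphism, `beta` is the base change of `beta ≫ ι` along
  -- `ι`.
  exact MorphismProperty.of_isPullback (P := @Smooth)
    (IsPullback.of_horiz_isIso_mono ⟨by rw [Category.id_comp]⟩ :
      IsPullback (𝟙 _) (beta k h) (beta k h ≫ (boundedJet k h).ι) (boundedJet k h).ι) this

theorem beta_comp_boundedJetStr (k : Type u) [CommRing k] {d n : ℕ} (h : d ≤ n) :
    beta k h ≫ boundedJetStr k h = sourceStr k d n := by
  rw [boundedJetStr, ← Category.assoc, beta_ι, betaAmbient, Category.assoc, ← Spec.map_comp,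
    ← CommRingCat.ofHom_comp,
    show (betaRing k d n).toRingHom.comp (algebraMap k (LineJetRing k n)) = algebraMap k _ from
      (betaRing k d n).comp_algebraMap, sourceStr,
    ← pullbackSpecIso_hom_fst k (MonicRing k d) (UnitJetRing k n), Category.assoc,
    ← Spec.map_comp, ← CommRingCat.ofHom_comp]

theorem locallyOfFiniteType_specStr (k A : Type u) [CommRing k] [CommRing A] [Algebra k A]
    [Algebra.FiniteType k A] : LocallyOfFiniteType (specStr k A) :=
  (HasRingHomProperty.Spec_iff (P := @LocallyOfFiniteType)).2
    (RingHom.finiteType_algebraMap.2 ‹_›)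

end WeierstrassJet

theorem mainTheorem7 (k : Type u) [Field k] (d n : ℕ) (h : d ≤ n) :
    (LocallyOfFiniteType (WeierstrassJet.sourceStr k d n) ∧
      QuasiCompact (WeierstrassJet.sourceStr k d n)) ∧
    (LocallyOfFiniteType (WeierstrassJet.boundedJetStr k h) ∧
      QuasiCompact (WeierstrassJet.boundedJetStr k h)) ∧
    WeierstrassJet.beta k h ≫ WeierstrassJet.boundedJetStr k h =
      WeierstrassJet.sourceStr k d n ∧
    Smooth (WeierstrassJet.beta k h) := by
  have h₁ := WeierstrassJet.locallyOfFiniteType_specStr k (WeierstrassJet.MonicRing k d)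
  have h₂ := WeierstrassJet.locallyOfFiniteType_specStr k (WeierstrassJet.UnitJetRing k n)
  have h₃ := WeierstrassJet.locallyOfFiniteType_specStr k (WeierstrassJet.LineJetRing k n)
  refine ⟨⟨inferInstance, inferInstance⟩, ⟨inferInstance, ?_⟩,
    WeierstrassJet.beta_comp_boundedJetStr k h, WeierstrassJet.smooth_beta k h⟩
  -- Open subschemes of a Noetherian affine scheme are quasi-compact.
  have : IsNoetherianRing (CommRingCat.of (WeierstrassJet.LineJetRing k n)) :=
    inferInstanceAs (IsNoetherianRing (MvPolynomial (Fin (n + 1)) k))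
  infer_instance
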